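/- Let $(X,A,Z,P_T,P_Z,r)$ be a POMDP with finite nonempty action set $A$, measurable state and observation spaces, an observation density $P_Z(z\mid x)$ with respect to a reference measure, and rewards $|r(x,a)|\le R_{\max}$, $R_{\max}>0$. Plan over $L$ decisions taken at depths $0,\dots,L-1$ (the value at depth $L$ is $0$), put $V_{\max}=L\,R_{\max}$, and let $N,N^O\ge 1$. Particle beliefs. A belief is a weighted particle set $b=\{(x^i,w^i)\}_{i=1}^N$, representing $\sum_i w^i\delta_{x^i}/\sum_i w^i$ (if all weights are zero, they are replaced by $1/N$), with $r(b,a)=\mathbb E_{x\mid b}[r(x,a)]$. Under action $a$: (CL) a closed-loop step draws $z$ from its law given $(b,a)$ (a state from $b$, a next state from $P_T(\cdot\mid\cdot,a)$, and $z$ from $P_Z$), independently moves the particles, $x'^i\sim P_T(\cdot\mid x^i,a)$, and multiplies the weights by $P_Z(z\mid x'^i)$; the history records $(a,z)$. (OL) an open-loop step moves the particles in the same way with unchanged weights; the history records $a$ only. (FO) a fully observable step draws $x$ from $b$ and $x'\sim P_T(\cdot\mid x,a)$, and the new belief is the point mass at $x'$; the history records $(a,x')$. Bounds. A topology $\tau=(\tau_U,\tau_L)$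 is a pair of (measurable) binary indicators $\beta_U,\beta_L$ of augmented histories, which say after each history whether the next step is simplified ($\beta=1$: FO under $\tau_U$, OL under $\tau_L$) or closed-loop ($\beta=0$). With $b'$ the random next belief (at the extended history), the bounds at depth $d<L$ are given by $$lb(b,a,\tau)=r(b,a)+\begin{cases}\max_{a'}\mathbb E_{b'}\,[lb(b',a',\tau)],&\beta_L=1\\ \mathbb E_{b'}\,[\max_{a'}lb(b',a',\tau)],&\beta_L=0,\end{cases}\qquad ub(b,a,\tau)=r(b,a)+\mathbb E_{b'}\,[\max_{a'}ub(b',a',\tau)].$$ Estimates. AT-SparsePFT computes $\widehat{lb},\widehat{ub}$ by the same recursions with each $\mathbb E_{b'}$ replaced by the average over independently sampled next beliefs, $N$ of them at nodes with $\beta=1$ and $N^O$ at nodes with $\beta=0$, and with the recursive estimates at the sampled beliefs in place of the exact values; at every node the estimates of the different actions use independent samples, and so do the estimates at different children. (The lower-bound and upper-bound runs may be coupled in any way.) Theorem. Fix a topology $\tau$, $\lambda>0$, a depth $d\in\{0,\dots,L-1\}$, and a node at depth $d$ with particle belief $\bar b_d$. Let $C=\min\{N,N^O\}$. Then with probability at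 least $$1-2\,|A|\,(|A|C)^{L-d}\exp\!\Bigl(-\frac{C\lambda^2}{2V_{\max}^2}\Bigr)$$ we have, simultaneously for all actions $a_d\in A$, $$|\widehat{ub}(\bar b_d,a_d,\tau)-ub(\bar b_d,a_d,\tau)|\le t,\qquad |\widehat{lb}(\bar b_d,a_d,\tau)-lb(\bar b_d,a_d,\tau)|\le t,\qquad t=\frac{(L-d)(L-d-1)}{2}\,\lambda .$$ -/

import Mathlib

open MeasureTheory ProbabilityTheory
open scoped NNReal ENNReal

noncomputable section

namespace ATSparsePFT

/-! ### Independent products of Markov kernels -/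

/-- Given the same input `x`, draw the coordinates independently, the `i`-th from `κ i x`. -/
def indepProd {ι α : Type*} {β : ι → Type*} [Fintype ι] [MeasurableSpace α]
    [∀ i, MeasurableSpace (β i)] (κ : ∀ i, Kernel α (β i)) [∀ i, IsMarkovKernel (κ i)] :
    Kernel α (∀ i, β i) where
  toFun x := Measure.pi fun i => κ i x
  measurable' := by
    refine Measurable.measure_of_isPiSystem_of_isProbabilityMeasure
      generateFrom_pi.symm isPiSystem_pi ?_
    rintro s ⟨t, ht, rfl⟩
    simp only [Measure.pi_pi]
    exact Finset.measurable_fun_prod _ fun i _ =>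
      Kernel.measurable_coe (κ i) (ht i (Set.mem_univ i))

instance {ι α : Type*} {β : ι → Type*} [Fintype ι] [MeasurableSpace α]
    [∀ i, MeasurableSpace (β i)] (κ : ∀ i, Kernel α (β i)) [∀ i, IsMarkovKernel (κ i)] :
    IsMarkovKernel (indepProd κ) :=
  ⟨fun x => inferInstanceAs (IsProbabilityMeasure (Measure.pi fun i => κ i x))⟩

/-! ### POMDPs -/

/-- A POMDP with states `X`, actions `A`, observations `Z`.  The observation model has a density
with respect to a reference measure (counting measure when `Z` is discrete); the density is what
weights the particles.  Initial beliefs are separate arguments. -/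
structure POMDP (X A Z : Type*) [MeasurableSpace X] [MeasurableSpace Z] where
  /-- the transition model `P_T(x' | x, a)` -/
  trans : A → Kernel X X
  markov_trans : ∀ a, IsMarkovKernel (trans a)
  /-- the reference measure on the observation space -/
  obsRef : Measure Z
  sigmaFinite_obsRef : SigmaFinite obsRef
  /-- the observation density `P_Z(z | x)` -/
  obsDensity : X → Z → ℝ≥0
  measurable_obsDensity : Measurable (Function.uncurry obsDensity)
  lintegral_obsDensity : ∀ x, ∫⁻ z, obsDensity x z ∂obsRef = 1
  /-- the state-dependent reward `r(x, a)` -/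
  reward : X → A → ℝ
  measurable_reward : ∀ a, Measurable fun x => reward x a

attribute [instance] POMDP.markov_trans POMDP.sigmaFinite_obsRef

/-- A weighted particle belief `{(x^i, w^i)}_{i=1}^N`. -/
abbrev ParticleBelief (X : Type*) (N : ℕ) := Fin N → X × ℝ≥0

/-- The normalized weight `w^i / ∑ w^j`; if all weights vanish they are reset to `1 / N`. -/
def normWeight {X : Type*} {N : ℕ} (b : ParticleBelief X N) (i : Fin N) : ℝ≥0 :=
  if ∑ j, (b j).2 = 0 then (N : ℝ≥0)⁻¹ else (b i).2 / ∑ j, (b j).2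

theorem sum_normWeight {X : Type*} {N : ℕ} [NeZero N] (b : ParticleBelief X N) :
    ∑ i, normWeight b i = 1 := by
  unfold normWeight
  split_ifs with h
  · simp
  · rw [← Finset.sum_div, div_self h]

section Particle

variable {X A Z : Type*} [MeasurableSpace X] [MeasurableSpace Z] {N : ℕ}

theorem measurable_normWeight (i : Fin N) :
    Measurable fun b : ParticleBelief X N => normWeight b i := by
  have hs : Measurable fun b : ParticleBelief X N => ∑ j, (b j).2 := by fun_prop
  exact Measurable.ite (hs (measurableSet_singleton 0)) measurable_const
    (Measurable.div (by fun_prop) hs)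

/-- The state distribution `∑ i, w^i δ_{x^i} / ∑ i, w^i` of a particle belief. -/
def beliefKernel (X : Type*) [MeasurableSpace X] (N : ℕ) : Kernel (ParticleBelief X N) X where
  toFun b := ∑ i, (normWeight b i : ℝ≥0∞) • Measure.dirac (b i).1
  measurable' := by
    refine Measure.measurable_of_measurable_coe _ fun s hs => ?_
    simp only [Measure.finsetSum_apply, Measure.smul_apply, smul_eq_mul]
    refine Finset.measurable_fun_sum _ fun i _ => Measurable.mul ?_ ?_
    · exact (measurable_normWeight i).coe_nnreal_ennreal
    · exact (Measure.measurable_coe hs).comp (Measure.measurable_dirac.comp (by fun_prop))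

instance [NeZero N] : IsMarkovKernel (beliefKernel X N) := by
  refine ⟨fun b => ⟨?_⟩⟩
  change (∑ i, (normWeight b i : ℝ≥0∞) • Measure.dirac (b i).1) Set.univ = 1
  simp only [Measure.finsetSum_apply, Measure.smul_apply, measure_univ, smul_eq_mul, mul_one]
  exact_mod_cast sum_normWeight b

/-- The observation model as a kernel. -/
def POMDP.obs (P : POMDP X A Z) : Kernel X Z :=
  Kernel.withDensity (Kernel.const X P.obsRef) fun x z => (P.obsDensity x z : ℝ≥0∞)

theorem POMDP.obs_apply (P : POMDP X A Z) (x : X) :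
    P.obs x = P.obsRef.withDensity fun z => (P.obsDensity x z : ℝ≥0∞) := by
  have h : Measurable (Function.uncurry fun x z => (P.obsDensity x z : ℝ≥0∞)) :=
    P.measurable_obsDensity.coe_nnreal_ennreal
  rw [POMDP.obs, Kernel.withDensity_apply _ h, Kernel.const_apply]

instance (P : POMDP X A Z) : IsMarkovKernel P.obs := by
  refine ⟨fun x => ⟨?_⟩⟩
  rw [P.obs_apply, withDensity_apply _ MeasurableSet.univ, Measure.restrict_univ,
    P.lintegral_obsDensity]

/-- The belief reward `r(b, a) = E_{x | b} [r(x, a)]`. -/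
def POMDP.beliefReward (P : POMDP X A Z) (b : ParticleBelief X N) (a : A) : ℝ :=
  ∑ i, (normWeight b i : ℝ) * P.reward (b i).1 a

theorem POMDP.measurable_beliefReward (P : POMDP X A Z) (a : A) :
    Measurable fun b : ParticleBelief X N => P.beliefReward b a := by
  unfold POMDP.beliefReward
  refine Finset.measurable_fun_sum _ fun i _ => Measurable.mul ?_ ?_
  · exact (measurable_normWeight i).coe_nnreal_real
  · exact (P.measurable_reward a).comp (by fun_prop)

/-- The law of `x'` given `b, a`: draw `x` from the belief, then `x'` from `P_T(· | x, a)`. -/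
def POMDP.nextState (P : POMDP X A Z) (N : ℕ) (a : A) : Kernel (ParticleBelief X N) X :=
  P.trans a ∘ₖ beliefKernel X N

/-- The law of the next observation given `b, a`. -/
def POMDP.nextObs (P : POMDP X A Z) (N : ℕ) (a : A) : Kernel (ParticleBelief X N) Z :=
  P.obs ∘ₖ P.nextState N a

/-- Propagation of the particles: independently `x'^i ∼ P_T(· | x^i, a)`. -/
def POMDP.propagate (P : POMDP X A Z) (N : ℕ) (a : A) :
    Kernel (ParticleBelief X N) (Fin N → X) :=
  indepProd fun i : Fin N => (P.trans a).comap (fun b : ParticleBelief X N => (b i).1)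
    (by fun_prop)

instance [NeZero N] (P : POMDP X A Z) (a : A) : IsMarkovKernel (P.nextState N a) := by
  unfold POMDP.nextState; infer_instance

instance [NeZero N] (P : POMDP X A Z) (a : A) : IsMarkovKernel (P.nextObs N a) := by
  unfold POMDP.nextObs; infer_instance

instance (P : POMDP X A Z) (a : A) : IsMarkovKernel (P.propagate N a) := by
  unfold POMDP.propagate; infer_instance

end Particle

/-! ### Augmented histories and topologies -/

/-- Augmented histories of length `n`.  Each step records the action and either what a simplified
step records (an element of `S`) or the observation of a closed-loop step.  For adaptive open-loop
(AOL) histories `S = Unit`: a simplified step records the action only.  For adaptive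
fully-observable (AFO) histories `S = X`: a simplified step records the true new state. -/
abbrev History (A S Z : Type*) (n : ℕ) := Fin n → A × (S ⊕ Z)

/-- The history extended by one step. -/
def History.extend {A S Z : Type*} {n : ℕ} (h : History A S Z n) (a : A) (s : S ⊕ Z) :
    History A S Z (n + 1) :=
  Fin.snoc (α := fun _ => A × (S ⊕ Z)) h (a, s)

/-- The binary indicators `β`: `true` selects a simplified step after the history, `false` a
closed-loop step. -/
structure Indicators (A S Z : Type*) [MeasurableSpace A] [MeasurableSpace S]
    [MeasurableSpace Z] where
  ind : ∀ n, History A S Z n → Bool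
  measurable_ind : ∀ n, Measurable (ind n)

/-- A topology `τ = (τ_U, τ_L)`. -/
structure Topology (X A Z : Type*) [MeasurableSpace X] [MeasurableSpace A]
    [MeasurableSpace Z] where
  /-- the indicators of the AFO policy, used by the upper bound -/
  upper : Indicators A X Z
  /-- the indicators of the AOL policy, used by the lower bound -/
  lower : Indicators A Unit Z

/-- A belief node: an augmented history with its particle belief. -/
abbrev Node (X A S Z : Type*) (N n : ℕ) := History A S Z n × ParticleBelief X N

section Steps

variable {X A S Z : Type*} [MeasurableSpace X] [MeasurableSpace A] [MeasurableSpace S]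
  [MeasurableSpace Z] {N n : ℕ}

theorem measurable_extend (a : A) :
    Measurable fun p : History A S Z n × (S ⊕ Z) => p.1.extend a p.2 := by
  refine measurable_pi_iff.2 fun i => ?_
  refine Fin.lastCases ?_ (fun j => ?_) i
  · simp only [History.extend, Fin.snoc_last]; fun_prop
  · simp only [History.extend, Fin.snoc_castSucc]; fun_prop

/-- Closed-loop step: an observation `z` is drawn given `b, a`, the particles are propagated, and
their weights are multiplied by `P_Z(z | x'^i)`; the history records `a` and `z`. -/
def closedUpdate (P : POMDP X A Z) (a : A)
    (p : Node X A S Z N n × (Z × (Fin N → X))) : Node X A S Z N (n + 1) :=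
  (p.1.1.extend a (Sum.inr p.2.1),
    fun i => (p.2.2 i, (p.1.2 i).2 * P.obsDensity (p.2.2 i) p.2.1))

/-- Open-loop step: the particles are propagated with unchanged weights; the history records `a`
only. -/
def openUpdate (a : A) (p : Node X A Unit Z N n × (Fin N → X)) : Node X A Unit Z N (n + 1) :=
  (p.1.1.extend a (Sum.inl ()), fun i => (p.2 i, (p.1.2 i).2))

/-- Fully observable step: the new state `x'` is revealed, so that the new belief is the point mass
at `x'`; the history records `a` and `x'`. -/
def revealUpdate (a : A) (p : Node X A X Z N n × X) : Node X A X Z N (n + 1) :=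
  (p.1.1.extend a (Sum.inl p.2), fun _ => (p.2, 1))

theorem measurable_closedUpdate (P : POMDP X A Z) (a : A) :
    Measurable (closedUpdate (S := S) (N := N) (n := n) P a) := by
  refine Measurable.prodMk ?_ (measurable_pi_iff.2 fun i => Measurable.prodMk (by fun_prop)
    (Measurable.mul (by fun_prop) ?_))
  · exact (measurable_extend a).comp
      (Measurable.prodMk (by fun_prop) (measurable_inr.comp (by fun_prop)))
  · exact P.measurable_obsDensity.comp (Measurable.prodMk (by fun_prop) (by fun_prop))

theorem measurable_openUpdate (a : A) :
    Measurable (openUpdate (X := X) (Z := Z) (N := N) (n := n) a) :=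
  Measurable.prodMk ((measurable_extend a).comp (Measurable.prodMk (by fun_prop)
    measurable_const)) (by fun_prop)

theorem measurable_revealUpdate (a : A) :
    Measurable (revealUpdate (X := X) (Z := Z) (N := N) (n := n) a) :=
  Measurable.prodMk ((measurable_extend a).comp (Measurable.prodMk (by fun_prop)
    (measurable_inl.comp (by fun_prop)))) (by fun_prop)

/-- The law of the child node reached by action `a` in a closed-loop step. -/
def closedStep (P : POMDP X A Z) (S : Type*) [MeasurableSpace S] (N n : ℕ) (a : A) :
    Kernel (Node X A S Z N n) (Node X A S Z N (n + 1)) :=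
  (Kernel.id ×ₖ ((P.nextObs N a ×ₖ P.propagate N a).comap Prod.snd measurable_snd)).map
    (closedUpdate P a)

/-- The law of the child node reached by action `a` in an open-loop step. -/
def openStep (P : POMDP X A Z) (N n : ℕ) (a : A) :
    Kernel (Node X A Unit Z N n) (Node X A Unit Z N (n + 1)) :=
  (Kernel.id ×ₖ ((P.propagate N a).comap Prod.snd measurable_snd)).map (openUpdate a)

/-- The law of the child node reached by action `a` in a fully observable step. -/
def revealStep (P : POMDP X A Z) (N n : ℕ) (a : A) :
    Kernel (Node X A X Z N n) (Node X A X Z N (n + 1)) :=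
  (Kernel.id ×ₖ ((P.nextState N a).comap Prod.snd measurable_snd)).map (revealUpdate a)

instance [NeZero N] (P : POMDP X A Z) (a : A) : IsMarkovKernel (closedStep P S N n a) :=
  Kernel.IsMarkovKernel.map _ (measurable_closedUpdate P a)

instance (P : POMDP X A Z) (a : A) : IsMarkovKernel (openStep P N n a) :=
  Kernel.IsMarkovKernel.map _ (measurable_openUpdate a)

instance [NeZero N] (P : POMDP X A Z) (a : A) : IsMarkovKernel (revealStep P N n a) :=
  Kernel.IsMarkovKernel.map _ (measurable_revealUpdate a)

end Steps

/-! ### The bounds and their sparse-sampling estimates -/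

/-- Maximum over the finite action set. -/
def maxA {A : Type*} [Fintype A] [Nonempty A] (f : A → ℝ) : ℝ :=
  Finset.univ.sup' Finset.univ_nonempty f

theorem measurable_maxA {A : Type*} [Fintype A] [Nonempty A] :
    Measurable (maxA : (A → ℝ) → ℝ) := by
  have h := Finset.measurable_sup' (δ := A → ℝ) (Finset.univ_nonempty (α := A))
    (f := fun a g => g a) (fun a _ => measurable_pi_apply a)
  convert h using 1
  ext g
  simp [maxA, Finset.sup'_apply]

section Sampling

variable {A : Type*} [Fintype A] [Nonempty A]

/-- Average over the `M` sampled children of their estimated optimal values; `q j a'` is the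
estimate at the `j`-th child for action `a'`. -/
def avgMax {M : ℕ} (q : Fin M → A → ℝ) : ℝ := (M : ℝ)⁻¹ * ∑ j, maxA (q j)

/-- Best average over the `M` sampled children, with one action for all of them. -/
def maxAvg {M : ℕ} (q : Fin M → A → ℝ) : ℝ := maxA fun a' => (M : ℝ)⁻¹ * ∑ j, q j a'

theorem measurable_avgMax {M : ℕ} : Measurable (avgMax : (Fin M → A → ℝ) → ℝ) :=
  (Finset.measurable_fun_sum _ fun j _ =>
    measurable_maxA.comp (measurable_pi_apply j)).const_mul _

theorem measurable_maxAvg {M : ℕ} : Measurable (maxAvg : (Fin M → A → ℝ) → ℝ) :=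
  measurable_maxA.comp (by fun_prop)

end Sampling

/-- Estimate of one action value by sparse sampling: draw `M` children of the node independently
from `step`, run the estimator `est` (a random vector of action-value estimates) independently at
each, aggregate the results by `agg`, and add the reward of the node. -/
def sampleEstimate {V W A : Type*} [MeasurableSpace V] [MeasurableSpace W] (M : ℕ)
    (rew : V → ℝ) (hrew : Measurable rew) (step : Kernel V W) [IsMarkovKernel step]
    (est : Kernel W (A → ℝ)) [IsMarkovKernel est]
    (agg : (Fin M → A → ℝ) → ℝ) (hagg : Measurable agg) : Kernel V ℝ :=
  Kernel.deterministic (fun p : V × (Fin M → A → ℝ) => rew p.1 + agg p.2)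
      ((hrew.comp measurable_fst).add (hagg.comp measurable_snd)) ∘ₖ
    (Kernel.id ×ₖ indepProd fun _ : Fin M => est ∘ₖ step)

instance {V W A : Type*} [MeasurableSpace V] [MeasurableSpace W] {M : ℕ} {rew : V → ℝ}
    (hrew : Measurable rew) (step : Kernel V W) [IsMarkovKernel step]
    (est : Kernel W (A → ℝ)) [IsMarkovKernel est] {agg : (Fin M → A → ℝ) → ℝ}
    (hagg : Measurable agg) : IsMarkovKernel (sampleEstimate M rew hrew step est agg hagg) := by
  unfold sampleEstimate; infer_instance

theorem measurable_nodeReward {X A S Z : Type*} [MeasurableSpace X] [MeasurableSpace A]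
    [MeasurableSpace S] [MeasurableSpace Z] (P : POMDP X A Z) (N n : ℕ) (a : A) :
    Measurable fun v : Node X A S Z N n => P.beliefReward v.2 a :=
  (P.measurable_beliefReward a).comp measurable_snd

theorem measurableSet_simplified {X A S Z : Type*} [MeasurableSpace X] [MeasurableSpace A]
    [MeasurableSpace S] [MeasurableSpace Z] (τ : Indicators A S Z) (N n : ℕ) :
    MeasurableSet {v : Node X A S Z N n | τ.ind n v.1 = true} :=
  (τ.measurable_ind n).comp measurable_fst (measurableSet_singleton true)

instance {X A S Z : Type*} [MeasurableSpace A] [MeasurableSpace S] [MeasurableSpace Z]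
    (τ : Indicators A S Z) (N n : ℕ) :
    DecidablePred (· ∈ {v : Node X A S Z N n | τ.ind n v.1 = true}) := fun v =>
  inferInstanceAs (Decidable (τ.ind n v.1 = true))

section Bounds

variable {X A Z : Type*} [MeasurableSpace X] [MeasurableSpace A] [MeasurableSpace Z]
  [Fintype A] [Nonempty A]

/-- Optimal AOL action values with `k` decisions left: open-loop steps maximize over the next
action before averaging, closed-loop steps after observing. -/
def aolQ (P : POMDP X A Z) (τ : Indicators A Unit Z) (N : ℕ) :
    (k n : ℕ) → Node X A Unit Z N n → A → ℝ
  | 0, _, _, _ => 0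
  | k + 1, n, v, a =>
    P.beliefReward v.2 a +
      if τ.ind n v.1 = true then
        maxA fun a' => ∫ v', aolQ P τ N k (n + 1) v' a' ∂(openStep P N n a v)
      else
        ∫ v', maxA (aolQ P τ N k (n + 1) v') ∂(closedStep P Unit N n a v)

/-- Optimal AFO action values with `k` decisions left: the next action is chosen after the new state
(fully observable step) or the observation (closed-loop step) is known. -/
def afoQ (P : POMDP X A Z) (τ : Indicators A X Z) (N : ℕ) :
    (k n : ℕ) → Node X A X Z N n → A → ℝ
  | 0, _, _, _ => 0
  | k + 1, n, v, a =>
    P.beliefReward v.2 a +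
      if τ.ind n v.1 = true then
        ∫ v', maxA (afoQ P τ N k (n + 1) v') ∂(revealStep P N n a v)
      else
        ∫ v', maxA (afoQ P τ N k (n + 1) v') ∂(closedStep P X N n a v)

/-- The sparse-sampling estimator of the AOL action values with `k` decisions left, as the law of
the vector of estimates given the node.  The estimates of different actions are independent.
Open-loop steps sample `N` next particle beliefs and maximize over the next action after averaging;
closed-loop steps sample `NO` observations and average the maxima. -/
def aolEstimator (P : POMDP X A Z) (τ : Indicators A Unit Z) (N NO : ℕ) [NeZero N] :
    (k n : ℕ) → {κ : Kernel (Node X A Unit Z N n) (A → ℝ) // IsMarkovKernel κ}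
  | 0, _ => ⟨Kernel.const _ (Measure.dirac 0), inferInstance⟩
  | k + 1, n =>
    haveI := (aolEstimator P τ N NO k (n + 1)).2
    ⟨indepProd fun a => Kernel.piecewise (measurableSet_simplified τ N n)
      (sampleEstimate N _ (measurable_nodeReward P N n a) (openStep P N n a)
        (aolEstimator P τ N NO k (n + 1)).1 maxAvg measurable_maxAvg)
      (sampleEstimate NO _ (measurable_nodeReward P N n a) (closedStep P Unit N n a)
        (aolEstimator P τ N NO k (n + 1)).1 avgMax measurable_avgMax), inferInstance⟩

/-- The sparse-sampling estimator of the AFO action values with `k` decisions left.  Fully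
observable steps sample `N` next states, closed-loop steps sample `NO` observations; both average
the maxima. -/
def afoEstimator (P : POMDP X A Z) (τ : Indicators A X Z) (N NO : ℕ) [NeZero N] :
    (k n : ℕ) → {κ : Kernel (Node X A X Z N n) (A → ℝ) // IsMarkovKernel κ}
  | 0, _ => ⟨Kernel.const _ (Measure.dirac 0), inferInstance⟩
  | k + 1, n =>
    haveI := (afoEstimator P τ N NO k (n + 1)).2
    ⟨indepProd fun a => Kernel.piecewise (measurableSet_simplified τ N n)
      (sampleEstimate N _ (measurable_nodeReward P N n a) (revealStep P N n a)
        (afoEstimator P τ N NO k (n + 1)).1 avgMax measurable_avgMax)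
      (sampleEstimate NO _ (measurable_nodeReward P N n a) (closedStep P X N n a)
        (afoEstimator P τ N NO k (n + 1)).1 avgMax measurable_avgMax), inferInstance⟩

/-- The lower bound `lb(b, a, τ)` at depth `d` (history `h`) of a tree with decisions at the depths
`0, …, L - 1`. -/
def lb (P : POMDP X A Z) (τ : Topology X A Z) (L : ℕ) {N d : ℕ} (h : History A Unit Z d)
    (b : ParticleBelief X N) (a : A) : ℝ :=
  aolQ P τ.lower N (L - d) d (h, b) a

/-- The upper bound `ub(b, a, τ)` at depth `d` (history `h`). -/
def ub (P : POMDP X A Z) (τ : Topology X A Z) (L : ℕ) {N d : ℕ} (h : History A X Z d)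
    (b : ParticleBelief X N) (a : A) : ℝ :=
  afoQ P τ.upper N (L - d) d (h, b) a

/-- The law of the estimates of `lb(b, a, τ)`, `a ∈ A`, with `NO` sampled observations. -/
def lbEstimateLaw (P : POMDP X A Z) (τ : Topology X A Z) (L NO : ℕ) {N d : ℕ} [NeZero N]
    (h : History A Unit Z d) (b : ParticleBelief X N) : Measure (A → ℝ) :=
  (aolEstimator P τ.lower N NO (L - d) d).1 (h, b)

/-- The law of the estimates of `ub(b, a, τ)`, `a ∈ A`, with `NO` sampled observations. -/
def ubEstimateLaw (P : POMDP X A Z) (τ : Topology X A Z) (L NO : ℕ) {N d : ℕ} [NeZero N]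
    (h : History A X Z d) (b : ParticleBelief X N) : Measure (A → ℝ) :=
  (afoEstimator P τ.upper N NO (L - d) d).1 (h, b)

end Bounds

end ATSparsePFT

end

/-! No union bound over the nodes of the search tree is needed: along the recursion only the mean
sup-norm error of the vector of estimates is controlled, and a tail bound is taken once, at the
root.

Suppose that with `k` decisions left the estimator has values bounded by `k R` and mean error at
most `ε` at every node (`IsAccurate`). The outputs of the recursive estimator at the sampled
children are i.i.d. given the parent. The maximum over actions and each coordinate are 1-Lipschitz
for the sup norm, so the expectation of either under the sampling law differs from the exact value
by at most `ε`. The empirical mean fluctuates about this expectation with sub-Gaussian variance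
proxy at most `(k R)^2 / C` by Hoeffding's lemma. Hence the error of one action estimate at the
parent, minus `ε`, has exponential moments at most `2|A|` times Gaussian ones
(`isStepEstimate_sampleEstimate`).

Taking the maximum over the actions raises the mean error only to `ε + λ`, provided `2|A|^2 E ≤ 1`
with `E = exp(-Cλ²/(2 Vmax²))` (`integral_norm_sub_le_of_hasExpTail`). With one decision left the
estimates are almost surely exact, so the mean error with `k ≥ 1` decisions left is at most `(k - 1)
λ`. If the proviso fails, the claimed probability bound is nonpositive.

At a root with `k + 1` decisions left, the tolerance `k(k+1)λ/2` exceeds the bias enough for the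
Chernoff bound to give `2|A| E^2` for each action (`IsStepEstimate.measureReal_lt_le`). A union
bound over the actions and the two bounds gives total failure probability at most `(2|A|E)^2`. Since
`2|A|E ≤ 1 ≤ (|A|C)^(L-d)`, this is below the claimed `2|A|(|A|C)^(L-d) E`. -/

namespace ATSparsePFT

/-! ### The maximum over the action set -/

section MaxA

variable {A : Type*} [Fintype A] [Nonempty A]

theorem le_maxA (f : A → ℝ) (a : A) : f a ≤ maxA f :=
  Finset.le_sup' f (Finset.mem_univ a)

theorem exists_eq_maxA (f : A → ℝ) : ∃ a, maxA f = f a := by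
  obtain ⟨a, -, h⟩ := Finset.exists_mem_eq_sup' (Finset.univ_nonempty (α := A)) f
  exact ⟨a, h⟩

/-- A maximizer of whichever function has the larger maximum is a witness. The existential form lets
a deviation of maxima be charged to one coordinate, to which a scalar concentration bound applies.
-/
theorem exists_abs_maxA_sub_le (f g : A → ℝ) : ∃ a, |maxA f - maxA g| ≤ |f a - g a| := by
  obtain ⟨a, ha⟩ := exists_eq_maxA f
  obtain ⟨c, hc⟩ := exists_eq_maxA g
  rcases le_total (maxA g) (maxA f) with h | h
  · refine ⟨a, ?_⟩
    rw [abs_of_nonneg (sub_nonneg.2 h)]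
    have := le_maxA g a
    exact le_trans (by linarith) (le_abs_self _)
  · refine ⟨c, ?_⟩
    rw [abs_of_nonpos (sub_nonpos.2 h)]
    have := le_maxA f c
    exact le_trans (by linarith) (neg_le_abs _)

theorem abs_maxA_sub_le (f g : A → ℝ) : |maxA f - maxA g| ≤ ‖f - g‖ := by
  obtain ⟨a, ha⟩ := exists_abs_maxA_sub_le f g
  exact ha.trans (norm_le_pi_norm (f - g) a)

theorem abs_maxA_le (f : A → ℝ) : |maxA f| ≤ ‖f‖ := by
  obtain ⟨a, ha⟩ := exists_eq_maxA f
  rw [ha]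
  exact norm_le_pi_norm f a

theorem abs_average_le {M : ℕ} [NeZero M] {f : Fin M → ℝ} {B : ℝ} (h : ∀ j, |f j| ≤ B) :
    |(M : ℝ)⁻¹ * ∑ j, f j| ≤ B := by
  have hM : (0 : ℝ) < M := by exact_mod_cast Nat.pos_of_neZero M
  rw [abs_mul, abs_of_pos (inv_pos.2 hM), inv_mul_le_iff₀ hM]
  calc |∑ j, f j| ≤ ∑ j, |f j| := Finset.abs_sum_le_sum_abs _ _
    _ ≤ ∑ _j : Fin M, B := Finset.sum_le_sum fun j _ => h j
    _ = M * B := by simp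

theorem abs_avgMax_le {M : ℕ} [NeZero M] {y : Fin M → A → ℝ} {B : ℝ} (h : ∀ j, ‖y j‖ ≤ B) :
    |avgMax y| ≤ B :=
  abs_average_le fun j => (abs_maxA_le (y j)).trans (h j)

theorem abs_maxAvg_le {M : ℕ} [NeZero M] {y : Fin M → A → ℝ} {B : ℝ} (h : ∀ j, ‖y j‖ ≤ B) :
    |maxAvg y| ≤ B := by
  obtain ⟨a, ha⟩ := exists_eq_maxA fun a' => (M : ℝ)⁻¹ * ∑ j, y j a'
  rw [maxAvg, ha]
  exact abs_average_le fun j => (norm_le_pi_norm (y j) a).trans (h j)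

end MaxA

/-! ### Exponential tails -/

/-- The exponential moments of the excess of `|y - c|` over `ε` are at most `n` times those of a
centred Gaussian of variance `σ`. -/
structure HasExpTail (ρ : Measure ℝ) (c ε σ n : ℝ) : Prop where
  integrable : ∀ θ, 0 ≤ θ → Integrable (fun y => Real.exp (θ * (|y - c| - ε))) ρ
  integral_le : ∀ θ, 0 ≤ θ →
    ∫ y, Real.exp (θ * (|y - c| - ε)) ∂ρ ≤ n * Real.exp (θ ^ 2 * σ / 2)

theorem HasExpTail.mono {ρ : Measure ℝ} {c ε σ σ' n : ℝ} (h : HasExpTail ρ c ε σ n)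
    (hn : 0 ≤ n) (hσ : σ ≤ σ') : HasExpTail ρ c ε σ' n := by
  refine ⟨h.integrable, fun θ hθ => (h.integral_le θ hθ).trans ?_⟩
  gcongr

/-- Markov's inequality for the exponential moment at `θ = s / σ`, the minimizer of `θ² σ / 2 - θ
s`. -/
theorem HasExpTail.measureReal_lt_le {ρ : Measure ℝ} [IsFiniteMeasure ρ] {c ε σ n s : ℝ}
    (h : HasExpTail ρ c ε σ n) (hσ : 0 < σ) (hs : 0 ≤ s) :
    ρ.real {y | ε + s < |y - c|} ≤ n * Real.exp (-(s ^ 2 / (2 * σ))) := by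
  have hθ : 0 ≤ s / σ := by positivity
  have hM := mul_meas_ge_le_integral_of_nonneg
    (ae_of_all ρ fun y => (Real.exp_pos (s / σ * (|y - c| - ε))).le) (h.integrable _ hθ)
    (Real.exp (s / σ * s))
  have hsub : ρ.real {y | ε + s < |y - c|} ≤
      ρ.real {y | Real.exp (s / σ * s) ≤ Real.exp (s / σ * (|y - c| - ε))} := by
    refine measureReal_mono fun y hy => ?_
    have hy' : ε + s < |y - c| := hy
    refine Real.exp_le_exp.2 (mul_le_mul_of_nonneg_left (by linarith) hθ)
  have hE := Real.exp_pos (s / σ * s)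
  have h1 := (mul_le_mul_of_nonneg_left hsub hE.le).trans (hM.trans (h.integral_le _ hθ))
  have h2 : n * Real.exp ((s / σ) ^ 2 * σ / 2) =
      Real.exp (s / σ * s) * (n * Real.exp (-(s ^ 2 / (2 * σ)))) := by
    rw [mul_left_comm, ← Real.exp_add]
    congr 2
    field_simp
    ring
  rw [h2] at h1
  exact le_of_mul_le_mul_left h1 hE

theorem integrable_exp_of_ae_abs_sub_le {ρ : Measure ℝ} [IsFiniteMeasure ρ] {c r D θ ε : ℝ}
    (hθ : 0 ≤ θ) (h : ∀ᵐ y ∂ρ, |y - r| ≤ D) :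
    Integrable (fun y => Real.exp (θ * (|y - c| - ε))) ρ := by
  refine Integrable.of_bound (by fun_prop) (Real.exp (θ * (D + |r - c| - ε))) ?_
  filter_upwards [h] with y hy
  rw [Real.norm_eq_abs, Real.abs_exp]
  refine Real.exp_le_exp.2 (mul_le_mul_of_nonneg_left ?_ hθ)
  have := abs_sub_le y r c
  linarith

/-- The expected maximum of finitely many deviations with exponential tails. -/
theorem integral_norm_sub_le_of_hasExpTail {A : Type*} [Fintype A] [Nonempty A]
    {ν : Measure (A → ℝ)} [IsProbabilityMeasure ν] {c : A → ℝ} {ε σ n lam : ℝ} (hσ : 0 < σ)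
    (hlam : 0 < lam) (hc : ∀ a, HasExpTail (ν.map (Function.eval a)) (c a) ε σ n)
    (hn : Fintype.card A * n * Real.exp (-(lam ^ 2 / (2 * σ))) ≤ 1)
    (hint : Integrable (fun y => ‖y - c‖) ν) :
    ∫ y, ‖y - c‖ ∂ν ≤ ε + lam := by
  -- This `θ` minimizes `θ² σ / 2 - θ lam`, with minimum `-lam² / (2σ)`, the exponent in `hn`.
  have hθ : 0 < lam / σ := by positivity
  set θ := lam / σ with hθdef
  -- The tangent bound `1 + x ≤ exp x` at `x = θ (|y a - c a| - ε - lam)`. The maximum over `a` is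
  -- then absorbed into a sum of exponentials, and after integration `hn` makes the correction term
  -- nonpositive.
  have hpt : ∀ y : A → ℝ, ‖y - c‖ ≤ ε + lam + θ⁻¹ *
      (∑ a, Real.exp (-(θ * lam)) * Real.exp (θ * (|y a - c a| - ε)) - 1) := by
    intro y
    refine (pi_norm_le_iff_of_nonempty _).2 fun a => ?_
    have key : 1 + θ * (|y a - c a| - (ε + lam)) ≤
        ∑ a, Real.exp (-(θ * lam)) * Real.exp (θ * (|y a - c a| - ε)) :=
      calc 1 + θ * (|y a - c a| - (ε + lam))
          ≤ Real.exp (θ * (|y a - c a| - (ε + lam))) := by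
            rw [add_comm]; exact Real.add_one_le_exp _
        _ = Real.exp (-(θ * lam)) * Real.exp (θ * (|y a - c a| - ε)) := by
            rw [← Real.exp_add]; congr 1; ring
        _ ≤ _ := Finset.single_le_sum
            (f := fun a => Real.exp (-(θ * lam)) * Real.exp (θ * (|y a - c a| - ε)))
            (fun _ _ => by positivity) (Finset.mem_univ a)
    rw [← sub_le_iff_le_add', le_inv_mul_iff₀ hθ, Pi.sub_apply, Real.norm_eq_abs]
    linarith
  have hi : ∀ a, Integrable (fun y : A → ℝ => Real.exp (θ * (|y a - c a| - ε))) ν := fun a =>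
    ((hc a).integrable θ hθ.le).comp_measurable (measurable_pi_apply a)
  have hle : ∀ a, ∫ y : A → ℝ, Real.exp (θ * (|y a - c a| - ε)) ∂ν ≤
      n * Real.exp (θ ^ 2 * σ / 2) := by
    intro a
    have h := (hc a).integral_le θ hθ.le
    rwa [integral_map (measurable_pi_apply a).aemeasurable (by fun_prop)] at h
  have hsum : Integrable (fun y : A → ℝ =>
      ∑ a, Real.exp (-(θ * lam)) * Real.exp (θ * (|y a - c a| - ε))) ν :=
    integrable_finsetSum _ fun a _ => (hi a).const_mul _
  have hsum' : Integrable (fun y : A → ℝ => θ⁻¹ *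
      (∑ a, Real.exp (-(θ * lam)) * Real.exp (θ * (|y a - c a| - ε)) - 1)) ν :=
    (hsum.sub (integrable_const _)).const_mul _
  calc ∫ y, ‖y - c‖ ∂ν
      ≤ ∫ y, (ε + lam + θ⁻¹ *
          (∑ a, Real.exp (-(θ * lam)) * Real.exp (θ * (|y a - c a| - ε)) - 1)) ∂ν :=
        integral_mono hint ((integrable_const _).add hsum') hpt
    _ = ε + lam + θ⁻¹ * (∑ a, Real.exp (-(θ * lam)) *
          ∫ y : A → ℝ, Real.exp (θ * (|y a - c a| - ε)) ∂ν - 1) := by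
        rw [integral_add (integrable_const _) hsum', integral_const_mul, integral_sub hsum (integrable_const _),
          integral_finsetSum _ fun a _ => (hi a).const_mul _]
        simp [integral_const_mul]
    _ ≤ ε + lam + θ⁻¹ * (∑ _a : A, Real.exp (-(θ * lam)) *
          (n * Real.exp (θ ^ 2 * σ / 2)) - 1) := by
        gcongr with a
        exact hle a
    _ = ε + lam + θ⁻¹ * (Fintype.card A * n * Real.exp (-(lam ^ 2 / (2 * σ))) - 1) := by
        have : Real.exp (-(lam ^ 2 / (2 * σ))) =
            Real.exp (-(θ * lam)) * Real.exp (θ ^ 2 * σ / 2) := by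
          rw [← Real.exp_add, hθdef]
          congr 1
          field_simp
          ring
        rw [this, Finset.sum_const, Finset.card_univ, nsmul_eq_mul]
        ring
    _ ≤ ε + lam := by
        have : θ⁻¹ * (Fintype.card A * n * Real.exp (-(lam ^ 2 / (2 * σ))) - 1) ≤ 0 :=
          mul_nonpos_of_nonneg_of_nonpos (by positivity) (by linarith)
        linarith

/-- Hoeffding's lemma for the empirical mean of a bounded function. -/
theorem hasSubgaussianMGF_average {E : Type*} [MeasurableSpace E] {ν : Measure E}
    [IsProbabilityMeasure ν] {M : ℕ} [NeZero M] {f : E → ℝ} (hf : Measurable f) {B : ℝ≥0}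
    (hB : ∀ᵐ y ∂ν, |f y| ≤ B) :
    HasSubgaussianMGF (fun y : Fin M → E => (M : ℝ)⁻¹ * ∑ j, f (y j) - ∫ x, f x ∂ν)
      (B ^ 2 / M) (Measure.pi fun _ => ν) := by
  have hM : (M : ℝ) ≠ 0 := by exact_mod_cast NeZero.ne M
  -- The range `[-B, B]` has half-length `B`, which gives Hoeffding's variance proxy `B²`.
  have h1 : HasSubgaussianMGF (fun x => f x - ∫ x, f x ∂ν) (B ^ 2) ν := by
    have h := hasSubgaussianMGF_of_mem_Icc (μ := ν) (a := -B) (b := B) hf.aemeasurable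
      (hB.mono fun y hy => abs_le.1 hy)
    convert h using 1
    ext
    push_cast
    rw [sub_neg_eq_add, Real.norm_eq_abs, abs_of_nonneg (by positivity)]
    ring
  have h2 : ∀ j : Fin M, HasSubgaussianMGF (fun y : Fin M → E => f (y j) - ∫ x, f x ∂ν)
      (B ^ 2) (Measure.pi fun _ => ν) := fun j =>
    HasSubgaussianMGF.of_map (X := fun x => f x - ∫ x, f x ∂ν) (Y := fun y : Fin M → E => y j)
      (measurable_pi_apply j).aemeasurable (by rwa [(measurePreserving_eval (fun _ : Fin M => ν) j).map_eq])
  have h3 := (HasSubgaussianMGF.sum_of_iIndepFun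
    (iIndepFun_pi (μ := fun _ : Fin M => ν) (X := fun _ x => f x - ∫ x, f x ∂ν)
      fun _ => (hf.sub_const _).aemeasurable) (s := Finset.univ)
    fun j _ => h2 j).const_mul (M : ℝ)⁻¹
  convert h3 using 1
  · ext y
    simp only [Finset.sum_sub_distrib, Finset.sum_const, Finset.card_univ, Fintype.card_fin,
      nsmul_eq_mul]
    field_simp
  · ext
    change ((B ^ 2 / M : ℝ≥0) : ℝ) = (M : ℝ)⁻¹ ^ 2 * ((∑ _j : Fin M, B ^ 2 : ℝ≥0) : ℝ)
    rw [Finset.sum_const, Finset.card_univ, Fintype.card_fin, nsmul_eq_mul]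
    push_cast
    field_simp

theorem abs_integral_le_of_ae_abs_le {E : Type*} [MeasurableSpace E] {ν : Measure E}
    [IsProbabilityMeasure ν] {f : E → ℝ} {B : ℝ} (h : ∀ᵐ x ∂ν, |f x| ≤ B) :
    |∫ x, f x ∂ν| ≤ B := by
  simpa using norm_integral_le_of_norm_le_const (μ := ν) (f := f) h

/-! ### One step of sparse sampling -/

section Sampling

variable {V W A : Type*} [MeasurableSpace V] [MeasurableSpace W]

theorem sampleEstimate_apply {M : ℕ} {rew : V → ℝ} (hrew : Measurable rew) (step : Kernel V W)
    [IsMarkovKernel step] (est : Kernel W (A → ℝ)) [IsMarkovKernel est]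
    {agg : (Fin M → A → ℝ) → ℝ} (hagg : Measurable agg) (v : V) :
    sampleEstimate M rew hrew step est agg hagg v =
      (Measure.pi fun _ : Fin M => (est ∘ₖ step) v).map fun y => rew v + agg y := by
  rw [sampleEstimate, Kernel.deterministic_comp_eq_map, Kernel.map_apply _ (by fun_prop),
    Kernel.prod_apply, Kernel.id_apply, Measure.dirac_prod, Measure.map_map (by fun_prop)
    (by fun_prop)]
  rfl

variable [Fintype A]

/-- The estimator `est` of the values `q` has values bounded by `B` and mean error at most `ε`. -/
structure IsAccurate (est : Kernel W (A → ℝ)) (q : W → A → ℝ) (B ε : ℝ) : Prop where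
  measurable : Measurable q
  norm_le : ∀ w, ‖q w‖ ≤ B
  ae_norm_le : ∀ w, ∀ᵐ y ∂est w, ‖y‖ ≤ B
  integral_le : ∀ w, ∫ y, ‖y - q w‖ ∂est w ≤ ε

namespace IsAccurate

variable {est : Kernel W (A → ℝ)} {q : W → A → ℝ} {B ε : ℝ}

theorem ae_norm_comp_le (h : IsAccurate est q B ε) (step : Kernel V W) (v : V) :
    ∀ᵐ y ∂(est ∘ₖ step) v, ‖y‖ ≤ B :=
  Kernel.ae_comp_of_ae_ae (measurableSet_le measurable_norm measurable_const)
    (ae_of_all _ h.ae_norm_le)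

/-- The bias of one sampling step: conditionally on the child, a 1-Lipschitz functional moves the
mean by at most the mean error there, and averaging over children preserves the bound. This is why
only a mean error has to be carried through the recursion. -/
theorem abs_integral_comp_sub_le [IsMarkovKernel est] (h : IsAccurate est q B ε) (step : Kernel V W)
    [IsMarkovKernel step] {f : (A → ℝ) → ℝ} (hf : Measurable f) (hb : ∀ y, |f y| ≤ ‖y‖)
    (hl : ∀ y z, |f y - f z| ≤ ‖y - z‖) (v : V) :
    |∫ y, f y ∂(est ∘ₖ step) v - ∫ w, f (q w) ∂step v| ≤ ε := by
  have hq := h.measurable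
  have hfi : Integrable f ((est ∘ₖ step) v) :=
    Integrable.of_bound hf.aestronglyMeasurable B
      ((h.ae_norm_comp_le step v).mono fun y hy => (hb y).trans hy)
  have hfw : ∀ w, Integrable f (est w) := fun w =>
    Integrable.of_bound hf.aestronglyMeasurable B
      ((h.ae_norm_le w).mono fun y hy => (hb y).trans hy)
  have hnw : ∀ w, Integrable (fun y => ‖y - q w‖) (est w) := fun w =>
    Integrable.of_bound (by fun_prop) (B + B) ((h.ae_norm_le w).mono fun y hy => by
      rw [norm_norm]
      exact (norm_sub_le _ _).trans (add_le_add hy (h.norm_le w)))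
  have hI : Integrable (fun w => ∫ y, f y ∂est w) (step v) := Integrable.of_bound
      (hf.stronglyMeasurable.integral_kernel (κ := est)).aestronglyMeasurable B
      (ae_of_all _ fun w => abs_integral_le_of_ae_abs_le
        ((h.ae_norm_le w).mono fun y hy => (hb y).trans hy))
  have hQ : Integrable (fun w => f (q w)) (step v) :=
    Integrable.of_bound (hf.comp hq).aestronglyMeasurable B
      (ae_of_all _ fun w => (hb _).trans (h.norm_le w))
  rw [Kernel.integral_comp hfi, ← integral_sub hI hQ]
  refine abs_integral_le_of_ae_abs_le (ae_of_all _ fun w => ?_)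
  have hw : |∫ y, f y ∂est w - f (q w)| ≤ ε := by
    have : ∫ y, f y ∂est w - f (q w) = ∫ y, (f y - f (q w)) ∂est w := by
      rw [integral_sub (hfw w) (integrable_const _)]
      simp
    rw [this]
    exact (norm_integral_le_of_norm_le (f := fun y => f y - f (q w)) (hnw w) (ae_of_all _ fun y => hl _ _)).trans
      (h.integral_le w)
  exact hw

end IsAccurate

/-- The law `ρ` of an estimate of `c` deviates from the reward `r` by at most `B`, as does `c`,
and its error has an exponential tail. -/
structure IsStepEstimate (ρ : Measure ℝ) (c r B ε σ n : ℝ) : Prop where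
  abs_sub_le : |c - r| ≤ B
  ae_abs_sub_le : ∀ᵐ y ∂ρ, |y - r| ≤ B
  hasExpTail : HasExpTail ρ c ε σ n

variable {est : Kernel W (A → ℝ)} [IsMarkovKernel est] {q : W → A → ℝ} {B ε : ℝ}

/-- The common core of the two aggregations. By `hdev` the error beyond the bias `ε` is dominated by
the centred empirical mean of some functional `f a`, where `a` may depend on the sample. Summing
exponentials over all `a` and both signs removes that dependence and produces the factor `2|A|`;
each summand is then bounded by Hoeffding's lemma. -/
theorem isStepEstimate_sampleEstimate (h : IsAccurate est q B ε) (hB0 : 0 ≤ B) {M : ℕ} [NeZero M]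
    {rew : V → ℝ} (hrew : Measurable rew) (step : Kernel V W) [IsMarkovKernel step]
    {agg : (Fin M → A → ℝ) → ℝ} (hagg : Measurable agg)
    (hbound : ∀ y : Fin M → A → ℝ, (∀ j, ‖y j‖ ≤ B) → |agg y| ≤ B) (v : V) {T : ℝ}
    (hT : |T| ≤ B) {f : A → (A → ℝ) → ℝ} (hf : ∀ a, Measurable (f a))
    (hfb : ∀ a y, |f a y| ≤ ‖y‖)
    (hdev : ∀ y : Fin M → A → ℝ, ∃ a, |agg y - T| - ε ≤
      |(M : ℝ)⁻¹ * ∑ j, f a (y j) - ∫ x, f a x ∂(est ∘ₖ step) v|) :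
    IsStepEstimate (sampleEstimate M rew hrew step est agg hagg v) (rew v + T) (rew v) B ε
      (B ^ 2 / M) (2 * Fintype.card A) := by
  have hae : ∀ᵐ y ∂sampleEstimate M rew hrew step est agg hagg v, |y - rew v| ≤ B := by
    rw [sampleEstimate_apply, ae_map_iff (by fun_prop)
      (measurableSet_le (by fun_prop) measurable_const)]
    have hall : ∀ᵐ y ∂(Measure.pi fun _ : Fin M => (est ∘ₖ step) v), ∀ j, ‖y j‖ ≤ B :=
      ae_all_iff.2 fun j =>
        (measurePreserving_eval (fun _ : Fin M => (est ∘ₖ step) v) j).quasiMeasurePreserving.ae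
          (h.ae_norm_comp_le step v)
    filter_upwards [hall] with y hy
    simpa using hbound y hy
  refine ⟨by simpa using hT, hae,
    fun θ hθ => integrable_exp_of_ae_abs_sub_le hθ hae, fun θ hθ => ?_⟩
  set ν := Measure.pi fun _ : Fin M => (est ∘ₖ step) v with hν
  set D : A → (Fin M → A → ℝ) → ℝ := fun a y =>
    (M : ℝ)⁻¹ * ∑ j, f a (y j) - ∫ x, f a x ∂(est ∘ₖ step) v with hD
  have hsub : ∀ a, HasSubgaussianMGF (D a) (⟨B, hB0⟩ ^ 2 / M) ν := fun a =>
    hasSubgaussianMGF_average (hf a)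
      ((h.ae_norm_comp_le step v).mono fun y hy => (hfb a y).trans hy)
  have hint := integrable_exp_of_ae_abs_sub_le (c := rew v + T) (ε := ε) hθ hae
  rw [sampleEstimate_apply] at hint ⊢
  rw [integral_map (by fun_prop) (by fun_prop)]
  have hi : ∀ a, Integrable (fun y => Real.exp (θ * D a y) + Real.exp (-θ * D a y)) ν :=
    fun a => ((hsub a).integrable_exp_mul θ).add ((hsub a).integrable_exp_mul (-θ))
  calc ∫ y, Real.exp (θ * (|rew v + agg y - (rew v + T)| - ε)) ∂ν
      ≤ ∫ y, ∑ a, (Real.exp (θ * D a y) + Real.exp (-θ * D a y)) ∂ν := by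
        refine integral_mono (hint.comp_measurable (by fun_prop))
          (integrable_finsetSum _ fun a _ => hi a) fun y => ?_
        obtain ⟨a, ha⟩ := hdev y
        calc Real.exp (θ * (|rew v + agg y - (rew v + T)| - ε))
            ≤ Real.exp (θ * |D a y|) := by
              rw [add_sub_add_left_eq_sub]
              exact Real.exp_le_exp.2 (mul_le_mul_of_nonneg_left ha hθ)
          _ ≤ Real.exp (θ * D a y) + Real.exp (-θ * D a y) := by
              rcases abs_cases (D a y) with ⟨h, -⟩ | ⟨h, -⟩
              · rw [h]; linarith [Real.exp_pos (-θ * D a y)]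
              · rw [h, mul_neg, neg_mul]; linarith [Real.exp_pos (θ * D a y)]
          _ ≤ _ := Finset.single_le_sum
              (f := fun a => Real.exp (θ * D a y) + Real.exp (-θ * D a y))
              (fun _ _ => by positivity) (Finset.mem_univ a)
    _ = ∑ a, (mgf (D a) ν θ + mgf (D a) ν (-θ)) := by
        rw [integral_finsetSum _ fun a _ => hi a]
        refine Finset.sum_congr rfl fun a _ => ?_
        rw [integral_add ((hsub a).integrable_exp_mul θ) ((hsub a).integrable_exp_mul (-θ))]
        rfl
    _ ≤ ∑ _a : A, (Real.exp (θ ^ 2 * (B ^ 2 / M) / 2) + Real.exp (θ ^ 2 * (B ^ 2 / M) / 2)) := by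
        have hexp : ∀ t : ℝ, Real.exp (((⟨B, hB0⟩ ^ 2 / M : ℝ≥0) : ℝ) * t ^ 2 / 2) =
            Real.exp (t ^ 2 * (B ^ 2 / M) / 2) := fun t => by
          push_cast; rw [mul_comm (t ^ 2)]; rfl
        gcongr with a
        · exact ((hsub a).mgf_le θ).trans_eq (hexp θ)
        · exact ((hsub a).mgf_le (-θ)).trans_eq (by rw [hexp, neg_sq])
    _ = 2 * Fintype.card A * Real.exp (θ ^ 2 * (B ^ 2 / M) / 2) := by
        rw [Finset.sum_const, Finset.card_univ, nsmul_eq_mul]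
        ring

variable [Nonempty A]

theorem isStepEstimate_avgMax (h : IsAccurate est q B ε) (hB0 : 0 ≤ B) {M : ℕ} [NeZero M]
    {rew : V → ℝ} (hrew : Measurable rew) (step : Kernel V W) [IsMarkovKernel step] (v : V) :
    IsStepEstimate (sampleEstimate M rew hrew step est avgMax measurable_avgMax v)
      (rew v + ∫ w, maxA (q w) ∂step v) (rew v) B ε (B ^ 2 / M) (2 * Fintype.card A) := by
  refine isStepEstimate_sampleEstimate h hB0 hrew step _ (fun y => abs_avgMax_le) v ?_
    (f := fun _ => maxA) (fun _ => measurable_maxA) (fun _ => abs_maxA_le) fun y => ?_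
  · exact abs_integral_le_of_ae_abs_le
      (ae_of_all _ fun w => (abs_maxA_le (q w)).trans (h.norm_le w))
  · have hbias := h.abs_integral_comp_sub_le step measurable_maxA abs_maxA_le abs_maxA_sub_le v
    have := abs_sub_le (avgMax y) (∫ x, maxA x ∂(est ∘ₖ step) v) (∫ w, maxA (q w) ∂step v)
    -- The functional is the same for every index, so any action serves; the superfluous factor
    -- `|A|` gives both aggregations the same constant.
    refine ⟨Classical.arbitrary A, ?_⟩
    change _ ≤ |avgMax y - _|
    linarith

theorem isStepEstimate_maxAvg (h : IsAccurate est q B ε) (hB0 : 0 ≤ B) {M : ℕ} [NeZero M]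
    {rew : V → ℝ} (hrew : Measurable rew) (step : Kernel V W) [IsMarkovKernel step] (v : V) :
    IsStepEstimate (sampleEstimate M rew hrew step est maxAvg measurable_maxAvg v)
      (rew v + maxA fun a => ∫ w, q w a ∂step v) (rew v) B ε (B ^ 2 / M)
      (2 * Fintype.card A) := by
  refine isStepEstimate_sampleEstimate h hB0 hrew step _ (fun y => abs_maxAvg_le) v ?_
    (f := fun a y => y a) measurable_pi_apply (fun a y => norm_le_pi_norm y a) fun y => ?_
  · obtain ⟨a, ha⟩ := exists_eq_maxA fun a => ∫ w, q w a ∂step v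
    rw [ha]
    exact abs_integral_le_of_ae_abs_le
      (ae_of_all _ fun w => (norm_le_pi_norm (q w) a).trans (h.norm_le w))
  -- The maximum is outside the average here, so the action realizing the deviation depends on the
  -- sample.
  · obtain ⟨a, ha⟩ := exists_abs_maxA_sub_le (fun a => (M : ℝ)⁻¹ * ∑ j, y j a)
      (fun a => ∫ w, q w a ∂step v)
    have hbias := h.abs_integral_comp_sub_le step (measurable_pi_apply a)
      (fun y => norm_le_pi_norm y a) (fun y z => norm_le_pi_norm (y - z) a) v
    have := abs_sub_le ((M : ℝ)⁻¹ * ∑ j, y j a) (∫ x, x a ∂(est ∘ₖ step) v)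
      (∫ w, q w a ∂step v)
    refine ⟨a, ?_⟩
    change |maxAvg y - _| ≤ _ at ha
    linarith

end Sampling

/-! ### Tail bound for a single action at the root -/

theorem IsStepEstimate.ae_abs_sub_le_add {ρ : Measure ℝ} {c r B ε σ n : ℝ}
    (h : IsStepEstimate ρ c r B ε σ n) : ∀ᵐ y ∂ρ, |y - c| ≤ B + B := by
  filter_upwards [h.ae_abs_sub_le] with y hy
  have h1 := _root_.abs_sub_le y r c
  have h2 := h.abs_sub_le
  rw [abs_sub_comm] at h2
  linarith

theorem IsStepEstimate.mono {ρ : Measure ℝ} {c r B ε σ σ' n : ℝ}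
    (h : IsStepEstimate ρ c r B ε σ n) (hn : 0 ≤ n) (hσ : σ ≤ σ') :
    IsStepEstimate ρ c r B ε σ' n :=
  ⟨h.abs_sub_le, h.ae_abs_sub_le, h.hasExpTail.mono hn hσ⟩

/-- Here `k` decisions remain below the node. The tolerance minus the bias is a margin `s` with `s L
≥ 2 k lam`, twice what a single exponential factor requires. The Chernoff exponent thus gains a
factor of four, of which two is kept: hence the square. -/
theorem IsStepEstimate.measureReal_lt_le {ρ : Measure ℝ} [IsProbabilityMeasure ρ]
    {c r R C lam m : ℝ} {k L : ℕ} (hm : 0 ≤ m) (hR : 0 < R) (hC : 0 < C) (hlam : 0 < lam)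
    (hkL : k < L)
    (h : IsStepEstimate ρ c r (k * R) ((k - 1 : ℕ) * lam) ((k * R) ^ 2 / C) m) :
    ρ.real {y | ((k : ℝ) + 1) * k / 2 * lam < |y - c|} ≤
      m * Real.exp (-(C * lam ^ 2 / (2 * (L * R) ^ 2))) ^ 2 := by
  -- For `k = 0` the variance proxy vanishes and the Chernoff bound is unavailable, but the range
  -- bound is also `0`, so the estimate is almost surely exact.
  rcases k with _ | k
  · have h0 : ρ {y | ((0 : ℕ) + 1 : ℝ) * (0 : ℕ) / 2 * lam < |y - c|} = 0 := by
      refine measure_eq_zero_iff_ae_notMem.2 ?_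
      filter_upwards [h.ae_abs_sub_le_add] with y hy
      simpa using hy
    rw [measureReal_def, h0, ENNReal.toReal_zero]
    positivity
  have hL : (k : ℝ) + 1 + 1 ≤ L := by exact_mod_cast hkL
  have hk0 : (0 : ℝ) ≤ k := k.cast_nonneg
  set s : ℝ := (((k : ℝ) + 1 + 1) * (k + 1) / 2 - k) * lam with hs
  have hs0 : 0 ≤ s := mul_nonneg (by nlinarith) hlam.le
  have hsL : 2 * ((k + 1) * lam) ≤ s * L :=
    calc 2 * ((k + 1) * lam) ≤ s * (k + 1 + 1) := by
          -- With `k` now shifted by one, `L` is at least `k + 2`; equality holds throughout for `k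
          -- = 0`, `L = 2`.
          have : s * (k + 1 + 1) = 2 * ((k + 1) * lam) + (k ^ 3 + 3 * k ^ 2) / 2 * lam := by
            rw [hs]; ring
          rw [this]
          exact le_add_of_nonneg_right (by positivity)
      _ ≤ s * L := mul_le_mul_of_nonneg_left hL hs0
  have ht := h.hasExpTail.measureReal_lt_le (by positivity) hs0
  have heq : (((k + 1 - 1 : ℕ) : ℝ) * lam + s) = (((k + 1 : ℕ) : ℝ) + 1) * (k + 1 : ℕ) / 2 * lam := by
    rw [Nat.add_sub_cancel, hs]
    push_cast
    ring
  rw [heq] at ht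
  refine ht.trans (mul_le_mul_of_nonneg_left ?_ hm)
  rw [← Real.exp_nat_mul, Real.exp_le_exp]
  have hL0 : (0 : ℝ) < L := by linarith
  push_cast
  rw [mul_neg, neg_le_neg_iff, ← mul_div_assoc, div_le_div_iff₀ (by positivity) (by positivity)]
  have hsq : (2 * (((k : ℝ) + 1) * lam)) ^ 2 ≤ (s * L) ^ 2 :=
    pow_le_pow_left₀ (by positivity) hsL 2
  have h1 : 2 * (C * lam ^ 2) * (2 * (((k + 1) * R) ^ 2 / C)) =
      (2 * (((k : ℝ) + 1) * lam)) ^ 2 * R ^ 2 := by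
    field_simp
  have h2 : 0 ≤ (s * L) ^ 2 * R ^ 2 := by positivity
  have h3 := mul_le_mul_of_nonneg_right hsq (sq_nonneg R)
  rw [h1]
  nlinarith

/-! ### From single actions to the vector of estimates -/

section Steps

variable {V A : Type*} [MeasurableSpace V] [Fintype A]

theorem map_eval_indepProd {β : A → Type*} [∀ a, MeasurableSpace (β a)]
    (ρ : ∀ a, Kernel V (β a)) [∀ a, IsMarkovKernel (ρ a)] (v : V) (a : A) :
    (indepProd ρ v).map (Function.eval a) = ρ a v :=
  (measurePreserving_eval (fun a => ρ a v) a).map_eq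

theorem ae_indepProd_of_forall (ρ : A → Kernel V ℝ) [∀ a, IsMarkovKernel (ρ a)] (v : V)
    {p : A → ℝ → Prop} (h : ∀ a, ∀ᵐ y ∂ρ a v, p a y) : ∀ᵐ y ∂indepProd ρ v, ∀ a, p a (y a) :=
  ae_all_iff.2 fun a =>
    (measurePreserving_eval (fun a => ρ a v) a).quasiMeasurePreserving.ae (h a)

theorem isAccurate_zero :
    IsAccurate (Kernel.const V (Measure.dirac (0 : A → ℝ))) 0 0 0 where
  measurable := measurable_const
  norm_le := by simp
  ae_norm_le w := by
    rw [Kernel.const_apply, ae_dirac_iff (measurableSet_le measurable_norm measurable_const)]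
    simp
  integral_le w := by
    rw [Kernel.const_apply, integral_dirac' _ _ (by fun_prop)]
    simp

/-- A union bound over the coordinates, for which the marginal laws suffice. -/
theorem measureReal_exists_lt_le {ν : Measure (A → ℝ)} [IsProbabilityMeasure ν] {c : A → ℝ}
    {t p : ℝ} (h : ∀ a, (ν.map (Function.eval a)).real {y | t < |y - c a|} ≤ p) :
    ν.real {y | ∃ a, t < |y a - c a|} ≤ Fintype.card A * p := by
  have hU : {y : A → ℝ | ∃ a, t < |y a - c a|} = ⋃ a, {y | t < |y a - c a|} := by
    ext; simp
  calc ν.real {y | ∃ a, t < |y a - c a|} ≤ ∑ a, ν.real {y | t < |y a - c a|} := by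
        rw [hU]; exact measureReal_iUnion_fintype_le _
    _ ≤ ∑ _a : A, p := by
        refine Finset.sum_le_sum fun a _ => le_trans (le_of_eq ?_) (h a)
        rw [map_measureReal_apply (measurable_pi_apply a)
          (measurableSet_lt measurable_const (by fun_prop))]
        rfl
    _ = Fintype.card A * p := by simp

variable [Nonempty A]

theorem measurable_integral_maxA {W : Type*} [MeasurableSpace W]
    {q : W → A → ℝ} (hq : Measurable q) (κ : Kernel V W) :
    Measurable fun v => ∫ w, maxA (q w) ∂κ v :=
  (measurable_maxA.comp hq).stronglyMeasurable.integral_kernel.measurable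

theorem measurable_maxA_integral {W : Type*} [MeasurableSpace W]
    {q : W → A → ℝ} (hq : Measurable q) (κ : Kernel V W) :
    Measurable fun v => maxA fun a => ∫ w, q w a ∂κ v :=
  measurable_maxA.comp (measurable_pi_lambda _ fun a =>
    ((measurable_pi_apply a).comp hq).stronglyMeasurable.integral_kernel.measurable)

/-- Independent estimates of the action values have a mean error of at most `ε + lam`, and of at
most twice their range. -/
theorem isAccurate_indepProd {ρ : A → Kernel V ℝ} [∀ a, IsMarkovKernel (ρ a)] {q r : V → A → ℝ}
    {R B ε ε' σ n lam : ℝ} (hq : Measurable q) (hr : ∀ v a, |r v a| ≤ R)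
    (h : ∀ v a, IsStepEstimate (ρ a v) (q v a) (r v a) B ε σ n)
    (hσ : 0 < σ) (hlam : 0 < lam)
    (hn : Fintype.card A * n * Real.exp (-(lam ^ 2 / (2 * σ))) ≤ 1)
    (hε' : B + B ≤ ε' ∨ ε + lam ≤ ε') :
    IsAccurate (indepProd ρ) q (B + R) ε' := by
  have hae : ∀ v, ∀ᵐ y ∂indepProd ρ v, ‖y - q v‖ ≤ B + B := fun v => by
    filter_upwards [ae_indepProd_of_forall ρ v fun a => (h v a).ae_abs_sub_le_add] with y hy
    exact (pi_norm_le_iff_of_nonempty _).2 hy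
  have hbd : ∀ {x r : ℝ}, |x - r| ≤ B → |r| ≤ R → |x| ≤ B + R := fun {x r} h₁ h₂ => by
    have h₃ := abs_add_le (x - r) r
    rw [sub_add_cancel] at h₃
    linarith
  refine ⟨hq, fun v => (pi_norm_le_iff_of_nonempty _).2 fun a => hbd (h v a).abs_sub_le (hr v a),
    fun v => ?_, fun v => ?_⟩
  · filter_upwards [ae_indepProd_of_forall ρ v fun a => (h v a).ae_abs_sub_le] with y hy
    exact (pi_norm_le_iff_of_nonempty _).2 fun a => hbd (hy a) (hr v a)
  · have habs : ∀ᵐ y ∂indepProd ρ v, |‖y - q v‖| ≤ B + B := by simpa using hae v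
    rcases hε' with hε' | hε'
    · exact ((le_abs_self _).trans (abs_integral_le_of_ae_abs_le habs)).trans hε'
    · refine (integral_norm_sub_le_of_hasExpTail hσ hlam (fun a => ?_) hn
        (Integrable.of_bound (by fun_prop) (B + B) habs)).trans hε'
      rw [map_eval_indepProd]
      exact (h v a).hasExpTail

/-- The induction step: one more decision adds `R` to the range and at most `lam` to the mean error.
Enlarging the proxy to its value at `L` makes one smallness condition `hn` serve all depths. -/
theorem isAccurate_indepProd_succ {ρ : A → Kernel V ℝ}
    [∀ a, IsMarkovKernel (ρ a)] {q r : V → A → ℝ} {R C lam : ℝ} {k L : ℕ} (hR : 0 < R)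
    (hC : 0 < C) (hlam : 0 < lam) (hkL : k < L)
    (hn : Fintype.card A * (2 * Fintype.card A) *
      Real.exp (-(C * lam ^ 2 / (2 * (L * R) ^ 2))) ≤ 1)
    (hq : Measurable q) (hr : ∀ v a, |r v a| ≤ R)
    (h : ∀ v a, IsStepEstimate (ρ a v) (q v a) (r v a) (k * R) ((k - 1 : ℕ) * lam)
      ((k * R) ^ 2 / C) (2 * Fintype.card A)) :
    IsAccurate (indepProd ρ) q ((k + 1 : ℕ) * R) (k * lam) := by
  have hL : (0 : ℝ) < L := by exact_mod_cast hkL.pos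
  have hle : ((k * R) ^ 2 / C : ℝ) ≤ (L * R) ^ 2 / C := by gcongr
  rw [Nat.cast_add_one, add_one_mul]
  refine isAccurate_indepProd hq hr (fun v a => (h v a).mono (by positivity) hle)
    (by positivity) hlam ?_ ?_
  · convert hn using 4
    field_simp
  -- With one decision left the range below is `0`, so the error is `0` and no `lam` is spent. The
  -- truncated `k - 1` is therefore harmless at `k = 0`, and the total stays one `lam` below the
  -- number of decisions.
  · rcases k with _ | k
    · left; simp
    · right
      rw [Nat.add_sub_cancel, Nat.cast_add_one, add_one_mul]

end Steps

theorem POMDP.abs_beliefReward_le {X A Z : Type*} [MeasurableSpace X] [MeasurableSpace Z]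
    (P : POMDP X A Z) {R : ℝ} (hR : ∀ x a, |P.reward x a| ≤ R) {N : ℕ} [NeZero N]
    (b : ParticleBelief X N) (a : A) : |P.beliefReward b a| ≤ R := by
  calc |P.beliefReward b a| ≤ ∑ i, |(normWeight b i : ℝ) * P.reward (b i).1 a| :=
        Finset.abs_sum_le_sum_abs _ _
    _ ≤ ∑ i, (normWeight b i : ℝ) * R := by
        gcongr with i
        rw [abs_mul, NNReal.abs_eq]
        exact mul_le_mul_of_nonneg_left (hR _ _) (NNReal.coe_nonneg _)
    _ = R := by
        rw [← Finset.sum_mul, ← NNReal.coe_sum, sum_normWeight]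
        simp

/-! ### The estimators of the bounds -/

section Bounds

variable {X A Z : Type*} [MeasurableSpace X] [MeasurableSpace A] [MeasurableSpace Z]
  [Fintype A] [Nonempty A]

theorem measurable_aolQ (P : POMDP X A Z) (τ : Indicators A Unit Z) (N k n : ℕ) :
    Measurable (aolQ P τ N k n) := by
  induction k generalizing n with
  | zero => exact measurable_const
  | succ k ih =>
    refine measurable_pi_lambda _ fun a => ?_
    simp only [aolQ]
    exact (measurable_nodeReward P N n a).add (Measurable.ite (measurableSet_simplified τ N n)
      (measurable_maxA_integral (ih (n + 1)) _) (measurable_integral_maxA (ih (n + 1)) _))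

theorem measurable_afoQ (P : POMDP X A Z) (τ : Indicators A X Z) (N k n : ℕ) :
    Measurable (afoQ P τ N k n) := by
  induction k generalizing n with
  | zero => exact measurable_const
  | succ k ih =>
    refine measurable_pi_lambda _ fun a => ?_
    simp only [afoQ]
    exact (measurable_nodeReward P N n a).add (Measurable.ite (measurableSet_simplified τ N n)
      (measurable_integral_maxA (ih (n + 1)) _) (measurable_integral_maxA (ih (n + 1)) _))

/-- The law of the estimate of one AOL action value with `k + 1` decisions left. -/
noncomputable def aolActionEstimator (P : POMDP X A Z) (τ : Indicators A Unit Z) (N NO : ℕ) [NeZero N]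
    (k n : ℕ) (a : A) : Kernel (Node X A Unit Z N n) ℝ :=
  haveI := (aolEstimator P τ N NO k (n + 1)).2
  Kernel.piecewise (measurableSet_simplified τ N n)
    (sampleEstimate N _ (measurable_nodeReward P N n a) (openStep P N n a)
      (aolEstimator P τ N NO k (n + 1)).1 maxAvg measurable_maxAvg)
    (sampleEstimate NO _ (measurable_nodeReward P N n a) (closedStep P Unit N n a)
      (aolEstimator P τ N NO k (n + 1)).1 avgMax measurable_avgMax)

instance (P : POMDP X A Z) (τ : Indicators A Unit Z) (N NO : ℕ) [NeZero N] (k n : ℕ) (a : A) :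
    IsMarkovKernel (aolActionEstimator P τ N NO k n a) := by
  have := (aolEstimator P τ N NO k (n + 1)).2
  unfold aolActionEstimator; infer_instance

theorem aolEstimator_succ (P : POMDP X A Z) (τ : Indicators A Unit Z) (N NO : ℕ) [NeZero N]
    (k n : ℕ) :
    (aolEstimator P τ N NO (k + 1) n).1 = indepProd (aolActionEstimator P τ N NO k n) := rfl

/-- The law of the estimate of one AFO action value with `k + 1` decisions left. -/
noncomputable def afoActionEstimator (P : POMDP X A Z) (τ : Indicators A X Z) (N NO : ℕ) [NeZero N]
    (k n : ℕ) (a : A) : Kernel (Node X A X Z N n) ℝ :=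
  haveI := (afoEstimator P τ N NO k (n + 1)).2
  Kernel.piecewise (measurableSet_simplified τ N n)
    (sampleEstimate N _ (measurable_nodeReward P N n a) (revealStep P N n a)
      (afoEstimator P τ N NO k (n + 1)).1 avgMax measurable_avgMax)
    (sampleEstimate NO _ (measurable_nodeReward P N n a) (closedStep P X N n a)
      (afoEstimator P τ N NO k (n + 1)).1 avgMax measurable_avgMax)

instance (P : POMDP X A Z) (τ : Indicators A X Z) (N NO : ℕ) [NeZero N] (k n : ℕ) (a : A) :
    IsMarkovKernel (afoActionEstimator P τ N NO k n a) := by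
  have := (afoEstimator P τ N NO k (n + 1)).2
  unfold afoActionEstimator; infer_instance

theorem afoEstimator_succ (P : POMDP X A Z) (τ : Indicators A X Z) (N NO : ℕ) [NeZero N]
    (k n : ℕ) :
    (afoEstimator P τ N NO (k + 1) n).1 = indepProd (afoActionEstimator P τ N NO k n) := rfl

variable {P : POMDP X A Z} {N NO : ℕ} [NeZero N] [NeZero NO]

theorem isStepEstimate_aolActionEstimator {τ : Indicators A Unit Z} {k n : ℕ} {B ε C : ℝ}
    (h : IsAccurate (aolEstimator P τ N NO k (n + 1)).1 (aolQ P τ N k (n + 1)) B ε)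
    (hB : 0 ≤ B) (hC : 0 < C) (hN : C ≤ N) (hNO : C ≤ NO) (v : Node X A Unit Z N n) (a : A) :
    IsStepEstimate (aolActionEstimator P τ N NO k n a v) (aolQ P τ N (k + 1) n v a)
      (P.beliefReward v.2 a) B ε (B ^ 2 / C) (2 * Fintype.card A) := by
  have := (aolEstimator P τ N NO k (n + 1)).2
  rw [aolActionEstimator, Kernel.piecewise_apply, aolQ]
  by_cases hτ : τ.ind n v.1 = true
  · rw [if_pos hτ, if_pos (show v ∈ {v : Node X A Unit Z N n | τ.ind n v.1 = true} from hτ)]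
    exact (isStepEstimate_maxAvg h hB (measurable_nodeReward P N n a) _ v).mono (by positivity)
      (by gcongr)
  · rw [if_neg hτ, if_neg (show v ∉ {v : Node X A Unit Z N n | τ.ind n v.1 = true} from hτ)]
    exact (isStepEstimate_avgMax h hB (measurable_nodeReward P N n a) _ v).mono (by positivity)
      (by gcongr)

theorem isStepEstimate_afoActionEstimator {τ : Indicators A X Z} {k n : ℕ} {B ε C : ℝ}
    (h : IsAccurate (afoEstimator P τ N NO k (n + 1)).1 (afoQ P τ N k (n + 1)) B ε)
    (hB : 0 ≤ B) (hC : 0 < C) (hN : C ≤ N) (hNO : C ≤ NO) (v : Node X A X Z N n) (a : A) :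
    IsStepEstimate (afoActionEstimator P τ N NO k n a v) (afoQ P τ N (k + 1) n v a)
      (P.beliefReward v.2 a) B ε (B ^ 2 / C) (2 * Fintype.card A) := by
  have := (afoEstimator P τ N NO k (n + 1)).2
  rw [afoActionEstimator, Kernel.piecewise_apply, afoQ]
  by_cases hτ : τ.ind n v.1 = true
  · rw [if_pos hτ, if_pos (show v ∈ {v : Node X A X Z N n | τ.ind n v.1 = true} from hτ)]
    exact (isStepEstimate_avgMax h hB (measurable_nodeReward P N n a) _ v).mono (by positivity)
      (by gcongr)
  · rw [if_neg hτ, if_neg (show v ∉ {v : Node X A X Z N n | τ.ind n v.1 = true} from hτ)]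
    exact (isStepEstimate_avgMax h hB (measurable_nodeReward P N n a) _ v).mono (by positivity)
      (by gcongr)

theorem isAccurate_aolEstimator (τ : Indicators A Unit Z) {R C lam : ℝ} {L : ℕ}
    (hR : 0 < R) (hreward : ∀ x a, |P.reward x a| ≤ R) (hC : 0 < C) (hN : C ≤ N) (hNO : C ≤ NO)
    (hlam : 0 < lam)
    (hn : Fintype.card A * (2 * Fintype.card A) *
      Real.exp (-(C * lam ^ 2 / (2 * (L * R) ^ 2))) ≤ 1) {k : ℕ} (hk : k ≤ L) (n : ℕ) :
    IsAccurate (aolEstimator P τ N NO k n).1 (aolQ P τ N k n) (k * R) ((k - 1 : ℕ) * lam) := by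
  induction k generalizing n with
  | zero =>
    simp only [Nat.zero_sub, Nat.cast_zero, zero_mul]
    exact isAccurate_zero
  | succ k ih =>
    exact isAccurate_indepProd_succ hR hC hlam hk hn (measurable_aolQ P τ N (k + 1) n)
      (fun v a => P.abs_beliefReward_le hreward v.2 a)
      (isStepEstimate_aolActionEstimator (ih (by omega) (n + 1)) (by positivity) hC hN hNO)

theorem isAccurate_afoEstimator (τ : Indicators A X Z) {R C lam : ℝ} {L : ℕ}
    (hR : 0 < R) (hreward : ∀ x a, |P.reward x a| ≤ R) (hC : 0 < C) (hN : C ≤ N) (hNO : C ≤ NO)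
    (hlam : 0 < lam)
    (hn : Fintype.card A * (2 * Fintype.card A) *
      Real.exp (-(C * lam ^ 2 / (2 * (L * R) ^ 2))) ≤ 1) {k : ℕ} (hk : k ≤ L) (n : ℕ) :
    IsAccurate (afoEstimator P τ N NO k n).1 (afoQ P τ N k n) (k * R) ((k - 1 : ℕ) * lam) := by
  induction k generalizing n with
  | zero =>
    simp only [Nat.zero_sub, Nat.cast_zero, zero_mul]
    exact isAccurate_zero
  | succ k ih =>
    exact isAccurate_indepProd_succ hR hC hlam hk hn (measurable_afoQ P τ N (k + 1) n)
      (fun v a => P.abs_beliefReward_le hreward v.2 a)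
      (isStepEstimate_afoActionEstimator (ih (by omega) (n + 1)) (by positivity) hC hN hNO)

end Bounds

/-! ### Union bound over the two estimators, and conclusion -/

/-- Two random vectors are simultaneously close to their targets, up to the sum of the failure
probabilities of their laws. -/
theorem one_sub_add_le_measureReal_and {A Ω : Type*} [Fintype A] [MeasurableSpace Ω]
    {μ : Measure Ω} [IsProbabilityMeasure μ] {f g : Ω → A → ℝ} {νf νg : Measure (A → ℝ)}
    (hf : HasLaw f νf μ) (hg : HasLaw g νg μ) {c c' : A → ℝ} {t p : ℝ}
    (hpf : νf.real {y | ∃ a, t < |y a - c a|} ≤ p)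
    (hpg : νg.real {y | ∃ a, t < |y a - c' a|} ≤ p) :
    1 - (p + p) ≤ μ.real {ω | ∀ a, |f ω a - c a| ≤ t ∧ |g ω a - c' a| ≤ t} := by
  have hm : ∀ c : A → ℝ, MeasurableSet {y : A → ℝ | ∃ a, t < |y a - c a|} := fun c => by
    rw [Set.ofPred_exists]
    exact MeasurableSet.iUnion fun a => measurableSet_lt measurable_const (by fun_prop)
  have key : ∀ {f : Ω → A → ℝ} {ν : Measure (A → ℝ)} {c : A → ℝ}, HasLaw f ν μ →
      ν.real {y | ∃ a, t < |y a - c a|} ≤ p → μ.real {ω | ∃ a, t < |f ω a - c a|} ≤ p := by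
    intro f ν c h hp
    rw [← h.map_eq, map_measureReal_apply_of_aemeasurable h.aemeasurable (hm c)] at hp
    exact hp
  set S := {ω | ∀ a, |f ω a - c a| ≤ t ∧ |g ω a - c' a| ≤ t} with hS
  have hcover : (Set.univ : Set Ω) ⊆ S ∪
      ({ω | ∃ a, t < |f ω a - c a|} ∪ {ω | ∃ a, t < |g ω a - c' a|}) := by
    intro ω _
    by_cases h1 : ∃ a, t < |f ω a - c a|
    · exact Or.inr (Or.inl h1)
    by_cases h2 : ∃ a, t < |g ω a - c' a|
    · exact Or.inr (Or.inr h2)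
    · push Not at h1 h2
      exact Or.inl fun a => ⟨h1 a, h2 a⟩
  have h1 : (1 : ℝ) ≤ μ.real S + (μ.real {ω | ∃ a, t < |f ω a - c a|} +
      μ.real {ω | ∃ a, t < |g ω a - c' a|}) :=
    calc (1 : ℝ) = μ.real Set.univ := probReal_univ.symm
      _ ≤ _ := measureReal_mono hcover
      _ ≤ _ := measureReal_union_le _ _
      _ ≤ _ := by gcongr; exact measureReal_union_le _ _
  linarith [key hf hpf, key hg hpg]

end ATSparsePFT

theorem theorem2 {X A Z : Type*} [MeasurableSpace X] [MeasurableSpace A] [MeasurableSpace Z]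
    [Fintype A] [Nonempty A] [DiscreteMeasurableSpace A]
    (P : ATSparsePFT.POMDP X A Z) (Rmax : ℝ) (hRmax : 0 < Rmax)
    (hreward : ∀ x a, |P.reward x a| ≤ Rmax)
    (L N NO : ℕ) [NeZero N] [NeZero NO] (τ : ATSparsePFT.Topology X A Z)
    (lam : ℝ) (hlam : 0 < lam) (d : ℕ) (hd : d < L)
    (b : ATSparsePFT.ParticleBelief X N)
    (hU : ATSparsePFT.History A X Z d) (hL : ATSparsePFT.History A Unit Z d)
    {Ω : Type*} [MeasurableSpace Ω] (μ : Measure Ω) [IsProbabilityMeasure μ]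
    (ubHat lbHat : Ω → A → ℝ)
    (hub : HasLaw ubHat (ATSparsePFT.ubEstimateLaw P τ L NO hU b) μ)
    (hlb : HasLaw lbHat (ATSparsePFT.lbEstimateLaw P τ L NO hL b) μ) :
    1 - 2 * (Fintype.card A : ℝ) * ((Fintype.card A : ℝ) * ((min N NO : ℕ) : ℝ)) ^ (L - d) *
        Real.exp (-(((min N NO : ℕ) : ℝ) * lam ^ 2 / (2 * ((L : ℝ) * Rmax) ^ 2))) ≤
      μ.real {ω | ∀ a : A,
        |ubHat ω a - ATSparsePFT.ub P τ L hU b a| ≤ ((L : ℝ) - d) * ((L : ℝ) - d - 1) / 2 * lam ∧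
        |lbHat ω a - ATSparsePFT.lb P τ L hL b a| ≤
          ((L : ℝ) - d) * ((L : ℝ) - d - 1) / 2 * lam} := by
  obtain ⟨k, hk⟩ : ∃ k, L - d = k + 1 := ⟨L - d - 1, by omega⟩
  have hkL : k < L := by omega
  have hsub : (L : ℝ) - d = k + 1 := by
    rw [← Nat.cast_sub hd.le, hk, Nat.cast_add_one]
  rw [hsub, add_sub_cancel_right]
  have hC1 : 1 ≤ min N NO := le_min (Nat.pos_of_neZero N) (Nat.pos_of_neZero NO)
  set C : ℝ := ((min N NO : ℕ) : ℝ) with hCdef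
  have hC : 1 ≤ C := Nat.one_le_cast.2 hC1
  have hC0 : 0 < C := by linarith
  have hN : C ≤ N := Nat.cast_le.2 (min_le_left N NO)
  have hNO : C ≤ NO := Nat.cast_le.2 (min_le_right N NO)
  set E := Real.exp (-(C * lam ^ 2 / (2 * ((L : ℝ) * Rmax) ^ 2))) with hE
  have hE0 : 0 < E := Real.exp_pos _
  have hA : (1 : ℝ) ≤ Fintype.card A := by exact_mod_cast Fintype.card_pos (α := A)
  set m : ℝ := (Fintype.card A : ℝ) with hm
  have hAC : 1 ≤ m * C := one_le_mul_of_one_le_of_one_le hA hC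
  -- Either the claimed lower bound is nonpositive, or `E` is small enough for the mean-error
  -- recursion.
  rcases le_or_gt 1 (2 * m * (m * C) ^ (L - d) * E) with htriv | hsmall
  · exact le_trans (by linarith) measureReal_nonneg
  have hmE : m * (2 * m) * E ≤ 1 := by
    refine le_trans ?_ hsmall.le
    -- At least one decision is left, so the power supplies the second factor `|A|` needed in `hmE`.
    have h1 : m ≤ (m * C) ^ (L - d) :=
      (le_mul_of_one_le_right (by linarith) hC).trans (le_self_pow₀ hAC (by omega))
    calc m * (2 * m) * E = 2 * m * m * E := by ring
      _ ≤ 2 * m * (m * C) ^ (L - d) * E := by gcongr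
  have hpU : (ATSparsePFT.ubEstimateLaw P τ L NO hU b).real
      {y | ∃ a, (k + 1 : ℝ) * k / 2 * lam < |y a - ATSparsePFT.ub P τ L hU b a|} ≤
      m * (2 * m * E ^ 2) := by
    unfold ATSparsePFT.ubEstimateLaw ATSparsePFT.ub
    rw [hk, ATSparsePFT.afoEstimator_succ]
    refine ATSparsePFT.measureReal_exists_lt_le fun a => ?_
    rw [ATSparsePFT.map_eval_indepProd]
    exact (ATSparsePFT.isStepEstimate_afoActionEstimator (ATSparsePFT.isAccurate_afoEstimator
      τ.upper hRmax hreward hC0 hN hNO hlam hmE hkL.le (d + 1)) (by positivity) hC0 hN hNO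
      (hU, b) a).measureReal_lt_le (by positivity) hRmax hC0 hlam hkL
  have hpL : (ATSparsePFT.lbEstimateLaw P τ L NO hL b).real
      {y | ∃ a, (k + 1 : ℝ) * k / 2 * lam < |y a - ATSparsePFT.lb P τ L hL b a|} ≤
      m * (2 * m * E ^ 2) := by
    unfold ATSparsePFT.lbEstimateLaw ATSparsePFT.lb
    rw [hk, ATSparsePFT.aolEstimator_succ]
    refine ATSparsePFT.measureReal_exists_lt_le fun a => ?_
    rw [ATSparsePFT.map_eval_indepProd]
    exact (ATSparsePFT.isStepEstimate_aolActionEstimator (ATSparsePFT.isAccurate_aolEstimator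
      τ.lower hRmax hreward hC0 hN hNO hlam hmE hkL.le (d + 1)) (by positivity) hC0 hN hNO
      (hL, b) a).measureReal_lt_le (by positivity) hRmax hC0 hlam hkL
  refine le_trans ?_ (ATSparsePFT.one_sub_add_le_measureReal_and hub hlb hpU hpL)
  have hpow : 1 ≤ (m * C) ^ (L - d) := one_le_pow₀ hAC
  have h2mE : 2 * m * E ≤ 1 := by
    refine le_trans ?_ hmE
    have : 0 < 2 * m * E := by positivity
    nlinarith
  -- The two failure probabilities add up to `4 m² E² = (2mE)²`, and one factor `2mE ≤ 1` is traded
  -- for the power.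
  have hfinal : 2 * m * E * (2 * m * E) ≤ 2 * m * E * (m * C) ^ (L - d) :=
    mul_le_mul_of_nonneg_left (h2mE.trans hpow) (by positivity)
  nlinarith
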